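/- Let $M$ be a compact, oriented, three-dimensional Riemannian manifold without boundary, with Hodge star $\ast$ (normalised by $\alpha\wedge\ast\beta=\langle\alpha,\beta\rangle\,dV$, $dV$ the Riemannian volume form) and musical isomorphism $\sharp:\Omega^1(M)\to\mathfrak X(M)$; all objects are smooth. Put \[ \mathfrak s=\mathfrak X(M)\times C^\infty(M),\quad \mathfrak s^\ast=(\Omega^1(M)\otimes\Omega^3(M))\times\Omega^3(M),\quad V=\Omega^1(M)\times\Omega^3(M),\quad V^\ast=\Omega^2(M)\times C^\infty(M), \] with the duality pairings \[ \langle(\xi,f),(\mathbf m,\rho)\rangle=\int_M\big(\mathbf m(\xi)+f\rho\big),\qquad \langle(e_\theta,e_\rho),(\theta,\rho)\rangle=\int_M\big(e_\theta\wedge\theta+e_\rho\,\rho\big), \] where $(\theta\otimes\rho)(\xi)=\theta(\xi)\rho$. On the pairs $(\mathbf m,\rho)\in\mathfrak s^\ast$ with $\rho$ nowhere vanishing let $\Phi(\mathbf m,\rho)=(\theta,\rho)\in V$, where $\theta$ is the one-form with $\mathbf m=\theta\otimes\rho$. Let $(\mathbf m,\rho)\in\mathfrak s^\ast$ with $\rho$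 nowhere vanishing and $\mathbf m=\theta\otimes\rho$. Then the tangent map $T_{(\mathbf m,\rho)}\Phi:\mathfrak s^\ast\to V$, $\delta\mapsto\frac{d}{dt}\big|_{t=0}\Phi\big((\mathbf m,\rho)+t\delta\big)$ (derivative taken pointwise on $M$), exists and is linear, and it has a dual map $T^\ast_{(\mathbf m,\rho)}\Phi:V^\ast\to\mathfrak s$: for every $e\in V^\ast$, $T^\ast_{(\mathbf m,\rho)}\Phi(e)$ is the unique element of $\mathfrak s$ such that \[ \big\langle T^\ast_{(\mathbf m,\rho)}\Phi(e),\delta\big\rangle=\big\langle e,T_{(\mathbf m,\rho)}\Phi(\delta)\big\rangle\qquad\text{for all }\delta\in\mathfrak s^\ast . \] This dual map is linear and is given, for all $(e_\theta,e_\rho)\in V^\ast$, by \[ T^\ast_{(\mathbf m,\rho)}\Phi(e_\theta,e_\rho)=\left(\frac{(\ast e_\theta)^\sharp}{\ast\rho},\; e_\rho-\frac{\ast(e_\theta\wedge\theta)}{\ast\rho}\right). \] -/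

import Mathlib

open Bundle Manifold Set MeasureTheory
open scoped ContDiff TensorProduct Topology

noncomputable section

namespace FluidDual

/-! ### Linear algebra on one tangent space -/

section Pointwise

variable {V : Type*}

/-- The wedge product of alternating forms (a sum over shuffles, no extra factors). -/
def wedge [AddCommGroup V] [Module ℝ V] {k l : ℕ}
    (α : V [⋀^Fin k]→ₗ[ℝ] ℝ) (β : V [⋀^Fin l]→ₗ[ℝ] ℝ) : V [⋀^Fin (k + l)]→ₗ[ℝ] ℝ :=
  ((LinearMap.mul' ℝ ℝ).compAlternatingMap (α.domCoprod β)).domDomCongr finSumFinEquiv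

/-- The contraction `(θ ⊗ ρ) ↦ θ(u) ρ` of a one-form density with a vector `u`. -/
def contract [AddCommGroup V] [Module ℝ V] (u : V) :
    (V [⋀^Fin 1]→ₗ[ℝ] ℝ) ⊗[ℝ] (V [⋀^Fin 3]→ₗ[ℝ] ℝ) →ₗ[ℝ] (V [⋀^Fin 3]→ₗ[ℝ] ℝ) :=
  TensorProduct.lift
    (LinearMap.mk₂ ℝ (fun (θ : V [⋀^Fin 1]→ₗ[ℝ] ℝ) (ρ : V [⋀^Fin 3]→ₗ[ℝ] ℝ) => θ ![u] • ρ)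
      (fun _ _ _ => by simp [add_smul]) (fun _ _ _ => by simp [mul_smul])
      (fun _ _ _ => by simp) (fun _ _ _ => smul_comm _ _ _))

/-- `w ↦ η(u₁, …, u_k, w₁, …, w_m)`: the first `k` slots of an alternating form are filled. -/
def fillLeft [AddCommGroup V] [Module ℝ V] {k m : ℕ}
    (η : V [⋀^Fin (k + m)]→ₗ[ℝ] ℝ) (u : Fin k → V) : V [⋀^Fin m]→ₗ[ℝ] ℝ where
  toFun w := η (Fin.append u w)
  map_update_add' {inst} w i a b := by
    have h : ∀ c, Fin.append u (@Function.update _ _ inst w i c)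
        = Function.update (Fin.append u w) (Fin.natAdd k i) c := by
      intro c; ext j
      refine Fin.addCases (fun j => ?_) (fun j => ?_) j
      · rw [Function.update_of_ne (by simp [Fin.ext_iff]; omega)]; simp
      · by_cases hj : j = i
        · subst hj; simp
        · rw [Function.update_of_ne (by simpa [Fin.ext_iff] using hj)]; simp [hj]
    simp [h]
  map_update_smul' {inst} w i c a := by
    have h : ∀ c, Fin.append u (@Function.update _ _ inst w i c)
        = Function.update (Fin.append u w) (Fin.natAdd k i) c := by
      intro c; ext j
      refine Fin.addCases (fun j => ?_) (fun j => ?_) j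
      · rw [Function.update_of_ne (by simp [Fin.ext_iff]; omega)]; simp
      · by_cases hj : j = i
        · subst hj; simp
        · rw [Function.update_of_ne (by simpa [Fin.ext_iff] using hj)]; simp [hj]
    simp [h]
  map_eq_zero_of_eq' w i j hw hij :=
    η.map_eq_zero_of_eq (Fin.append u w) (i := Fin.natAdd k i) (j := Fin.natAdd k j)
      (by simpa using hw) (by simpa [Fin.ext_iff] using hij)

variable [NormedAddCommGroup V] [InnerProductSpace ℝ V]

/-- The Hodge star `⋀ᵏ V* → ⋀ᵐ V*` of an inner product space of dimension `k + m` with volume form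
`vol`: `(⋆α)(w) = (1/k!) ∑ α(b_{i₁}, …, b_{i_k}) vol(b_{i₁}, …, b_{i_k}, w)` for an orthonormal
basis `b`. This is the convention `α ∧ ⋆β = ⟨α, β⟩ vol`. -/
def hodgeStar [FiniteDimensional ℝ V] {k m : ℕ} (vol : V [⋀^Fin (k + m)]→ₗ[ℝ] ℝ)
    (α : V [⋀^Fin k]→ₗ[ℝ] ℝ) : V [⋀^Fin m]→ₗ[ℝ] ℝ :=
  ((k.factorial : ℝ)⁻¹) • ∑ i : Fin k → Fin (Module.finrank ℝ V),
    α (fun a => stdOrthonormalBasis ℝ V (i a)) •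
      fillLeft vol (fun a => stdOrthonormalBasis ℝ V (i a))

/-- The musical isomorphism `♯`: `⟨θ^♯, w⟩ = θ(w)`. -/
def sharp [FiniteDimensional ℝ V] (θ : V [⋀^Fin 1]→ₗ[ℝ] ℝ) : V :=
  haveI : CompleteSpace V := FiniteDimensional.complete ℝ V
  (InnerProductSpace.toDual ℝ V).symm
    (LinearMap.toContinuousLinearMap ((AlternatingMap.ofSubsingleton ℝ V ℝ (0 : Fin 1)).symm θ))

end Pointwise

/-- The model space `ℝ³`. -/
abbrev E3 : Type := EuclideanSpace ℝ (Fin 3)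

variable (M : Type*) [TopologicalSpace M] [ChartedSpace E3 M] [IsManifold (𝓡 3) ∞ M]

variable {M} in
/-- The tangent vector at `x` with constant coordinates `v` in the chart around `x₀`. -/
def coordVec (x₀ x : M) (v : E3) : TangentSpace (𝓡 3) x :=
  (trivializationAt E3 (TangentSpace (𝓡 3)) x₀).symmL ℝ x v

variable {M} in
/-- The coordinate frame `∂₁, ∂₂, ∂₃` at `x` of the chart around `x₀`. -/
def coordBasis (x₀ x : M) (hx : x ∈ (chartAt E3 x₀).source) :
    Module.Basis (Fin 3) ℝ (TangentSpace (𝓡 3) x) :=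
  (EuclideanSpace.basisFun (Fin 3) ℝ).toBasis.map
    ((trivializationAt E3 (TangentSpace (𝓡 3)) x₀).linearEquivAt ℝ x hx).symm

/-- Smooth vector fields. -/
abbrev VField := Cₛ^∞⟮𝓡 3; E3, (fun x : M => TangentSpace (𝓡 3) x)⟯

/-- Smooth functions. -/
abbrev SFun := C^∞⟮𝓡 3, M; ℝ⟯

/-- `Ω^k(M)`: fields of alternating `k`-forms on the tangent spaces whose components in every
chart are smooth. -/
def DForm (k : ℕ) : Submodule ℝ (∀ x : M, TangentSpace (𝓡 3) x [⋀^Fin k]→ₗ[ℝ] ℝ) where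
  carrier := {η | ∀ (x₀ : M) (v : Fin k → E3),
    ContMDiffOn (𝓡 3) 𝓘(ℝ) ∞ (fun x => η x (fun i => coordVec x₀ x (v i)))
      (chartAt E3 x₀).source}
  add_mem' ha hb x₀ v := (ha x₀ v).add (hb x₀ v)
  zero_mem' _ _ := contMDiffOn_const
  smul_mem' c _ ha x₀ v :=
    ContMDiffOn.congr ((contMDiffOn_const (I := 𝓡 3) (I' := 𝓘(ℝ)) (n := ∞) (c := c)).smul (ha x₀ v))
      fun _ _ => rfl

/-- `Ω¹(M) ⊗ Ω³(M)`: smooth sections of `T*M ⊗ ⋀³T*M` (smooth components in every chart). -/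
def OneFormDensity : Submodule ℝ (∀ x : M,
    (TangentSpace (𝓡 3) x [⋀^Fin 1]→ₗ[ℝ] ℝ) ⊗[ℝ] (TangentSpace (𝓡 3) x [⋀^Fin 3]→ₗ[ℝ] ℝ)) where
  carrier := {m | ∀ (x₀ : M) (u : E3) (v : Fin 3 → E3),
    ContMDiffOn (𝓡 3) 𝓘(ℝ) ∞
      (fun x => contract (coordVec x₀ x u) (m x) (fun i => coordVec x₀ x (v i)))
      (chartAt E3 x₀).source}
  add_mem' ha hb x₀ u v :=
    ((ha x₀ u v).add (hb x₀ u v)).congr fun x _ => by simp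
  zero_mem' _ _ _ := by simpa using contMDiffOn_const
  smul_mem' c _ ha x₀ u v :=
    ContMDiffOn.congr
      ((contMDiffOn_const (I := 𝓡 3) (I' := 𝓘(ℝ)) (n := ∞) (c := c)).smul (ha x₀ u v))
      fun x _ => by simp

/-- The Lie algebra `𝔰 = 𝔛(M) × C^∞(M)`, as a vector space. -/
abbrev LieS := VField M × SFun M

/-- Its dual `𝔰* = (Ω¹(M) ⊗ Ω³(M)) × Ω³(M)`: momentum and density. -/
abbrev LieSDual := OneFormDensity M × DForm M 3

/-- `V = Ω¹(M) × Ω³(M)`: velocity and density. -/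
abbrev Vel := DForm M 1 × DForm M 3

/-- `V* = Ω²(M) × Ω⁰(M)`. -/
abbrev VelDual := DForm M 2 × SFun M

/-- An orientation of `M`: an orientation of every tangent space which, compared with the
coordinate frame of any chart, is locally constant. -/
structure MOrientation where
  orient : ∀ x : M, Orientation ℝ (TangentSpace (𝓡 3) x) (Fin 3)
  locallyConstant : ∀ x₀ : M, IsLocallyConstant
    (fun x : (chartAt E3 x₀).source => orient x = (coordBasis x₀ x x.2).orientation)

section Integration

variable {M}
variable (o : MOrientation M)

open Classical in
/-- The component `± η(∂₁, ∂₂, ∂₃)` at `x` of a three-form in the chart around `x₀`, with sign `+`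
where the chart preserves the orientation and `-` where it reverses it. -/
def chartDensity (η : ∀ x : M, TangentSpace (𝓡 3) x [⋀^Fin 3]→ₗ[ℝ] ℝ) (x₀ x : M) : ℝ :=
  if hx : x ∈ (chartAt E3 x₀).source then
    (if o.orient x = (coordBasis x₀ x hx).orientation then 1 else -1) * η x (coordBasis x₀ x hx)
  else 0

variable (M) in
/-- A smooth partition of unity subordinate to the charts. -/
def chartPartition [T2Space M] [CompactSpace M] : SmoothPartitionOfUnity M (𝓡 3) M univ :=
  (SmoothPartitionOfUnity.exists_isSubordinate_chartAt_source (𝓡 3) M).choose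

/-- The integral `∫_M η` of a three-form over the compact oriented manifold `M`. -/
def integralM [T2Space M] [CompactSpace M]
    (η : ∀ x : M, TangentSpace (𝓡 3) x [⋀^Fin 3]→ₗ[ℝ] ℝ) : ℝ :=
  ∑ᶠ x₀ : M, ∫ y in (chartAt E3 x₀).target,
    chartPartition M x₀ ((chartAt E3 x₀).symm y) * chartDensity o η x₀ ((chartAt E3 x₀).symm y)

/-- The pairing `⟨(ξ, f), (𝐦, ρ)⟩ = ∫_M (𝐦(ξ) + f ρ)` of `𝔰` and `𝔰*`, which is
`∫_M (θ(ξ) + f) ρ` for `𝐦 = θ ⊗ ρ`. -/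
def pairS [T2Space M] [CompactSpace M] (q : LieS M) (p : LieSDual M) : ℝ :=
  integralM o (fun x => contract (q.1 x) (p.1.1 x) + q.2 x • p.2.1 x)

/-- The pairing `⟨(e_θ, e_ρ), (θ, ρ)⟩ = ∫_M (e_θ ∧ θ + e_ρ ρ)` of `V*` and `V`. -/
def pairV [T2Space M] [CompactSpace M] (e : VelDual M) (τ : Vel M) : ℝ :=
  integralM o (fun x => wedge (e.1.1 x) (τ.1.1 x) + e.2 x • τ.2.1 x)

end Integration

section MapPhi

variable {M}

open Classical in
/-- The map `Φ : (𝐦, ρ) ↦ (θ, ρ)` with `𝐦 = θ ⊗ ρ`, for nowhere vanishing `ρ`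
(and a dummy value elsewhere). -/
def Phi (p : LieSDual M) : Vel M :=
  if h : (∀ x, p.2.1 x ≠ 0) ∧ ∃ θ : DForm M 1, ∀ x, p.1.1 x = θ.1 x ⊗ₜ[ℝ] p.2.1 x then
    (h.2.choose, p.2)
  else 0

/-- `T` is the tangent map of `Φ` at `p`: for every `δ`, `T δ` is the derivative at `t = 0` of
`Φ(p + t δ)`, evaluated at every point of `M` and on all tangent vectors there. -/
def IsTangentMapPhi (p : LieSDual M) (T : LieSDual M →ₗ[ℝ] Vel M) : Prop :=
  ∀ (δ : LieSDual M) (x : M),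
    (∀ v, HasDerivAt (fun t : ℝ => (Phi (p + t • δ)).1.1 x v) ((T δ).1.1 x v) 0) ∧
    (∀ v, HasDerivAt (fun t : ℝ => (Phi (p + t • δ)).2.1 x v) ((T δ).2.1 x v) 0)

/-- `D : V* → 𝔰` is the dual of `T : 𝔰* → V`: `D e` is the one and only element of `𝔰` with
`⟨D e, δ⟩ = ⟨e, T δ⟩` for all `δ`. -/
def IsDualMap [T2Space M] [CompactSpace M] (o : MOrientation M)
    (T : LieSDual M →ₗ[ℝ] Vel M) (D : VelDual M →ₗ[ℝ] LieS M) : Prop :=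
  ∀ (e : VelDual M) (q : LieS M), q = D e ↔ ∀ δ : LieSDual M, pairS o q δ = pairV o e (T δ)

end MapPhi

section Riemannian

variable {M}

instance finrank_tangentSpace (x : M) :
    Fact (Module.finrank ℝ (TangentSpace (𝓡 3) x) = 3) :=
  ⟨(finrank_euclideanSpace_fin : Module.finrank ℝ E3 = 3)⟩

instance finiteDimensional_tangentSpace (x : M) :
    FiniteDimensional ℝ (TangentSpace (𝓡 3) x) :=
  inferInstanceAs (FiniteDimensional ℝ E3)

variable [RiemannianBundle (fun x : M => TangentSpace (𝓡 3) x)] (o : MOrientation M)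

/-- `⋆ : Ω³ → Ω⁰` at a point, as a number: `ρ = (⋆ρ) dV`. -/
def star3 (x : M) (ρ : TangentSpace (𝓡 3) x [⋀^Fin 3]→ₗ[ℝ] ℝ) : ℝ :=
  hodgeStar (k := 3) (m := 0) (o.orient x).volumeForm ρ ![]

/-- `⋆ : Ω² → Ω¹` at a point. -/
def star2 (x : M) (α : TangentSpace (𝓡 3) x [⋀^Fin 2]→ₗ[ℝ] ℝ) :
    TangentSpace (𝓡 3) x [⋀^Fin 1]→ₗ[ℝ] ℝ :=
  hodgeStar (k := 2) (m := 1) (o.orient x).volumeForm α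

end Riemannian

end FluidDual

end

open FluidDual

noncomputable section

namespace FluidDual

section Pointwise

variable {V : Type*}

/-! ### Alternating forms on a three-dimensional vector space -/

section Algebra

variable [AddCommGroup V] [Module ℝ V]

/-! At each point the top forms are a line spanned by `ρ`, so "dividing by `ρ`" makes sense: `ratio`
divides a three-form, `velocity` a one-form density. Along `p + tδ` with `δ = (δm, δρ)` the velocity
is `(θ ⊗ ρ + t δm) / (ρ + t δρ)`, and the quotient rule gives the derivative `δm/ρ - (δρ/ρ) θ`,
which is `tangentPhi`.

Duality holds already between the integrands. The key identity is `e ∧ β = β((⋆e)^♯) dV = β(X) ρ`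
with `X = (⋆e)^♯ / ⋆ρ` (`wedge_eq_apply_dualVector_smul`). It turns `e ∧ (δm/ρ)` into `δm(X)`, while
`(δρ/ρ) (e ∧ θ) = ((e ∧ θ)/ρ) δρ` moves the other term onto the density slot (`pairS_dualPhi`).

Uniqueness is nondegeneracy of the pairing: if `(ξ, f)` is the difference of two candidates and `μ =
±ρ` is the positive choice, testing against `(ξ^♭ ⊗ μ, f μ)` gives `∫ (|ξ|² + f²) μ = 0`. A
nonnegative continuous top form with zero integral vanishes (`eq_zero_of_integralM_eq_zero`), so `ξ
= 0` and `f = 0`. -/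

theorem sum_perm_fin_three (g : Fin 3 → Fin 3 → Fin 3 → ℝ) :
    ∑ σ : Equiv.Perm (Fin 3), ((Equiv.Perm.sign σ : ℤ) : ℝ) * g (σ 0) (σ 1) (σ 2)
      = g 0 1 2 - g 1 0 2 - g 2 1 0 - g 0 2 1 + g 1 2 0 + g 2 0 1 := by
  have huniv : (Finset.univ : Finset (Equiv.Perm (Fin 3))) =
      {1, Equiv.swap 0 1, Equiv.swap 0 2, Equiv.swap 1 2, Equiv.swap 0 1 * Equiv.swap 1 2,
        Equiv.swap 1 2 * Equiv.swap 0 1} := by decide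
  rw [huniv]
  iterate 5 rw [Finset.sum_insert (by decide)]
  rw [Finset.sum_singleton]
  have e1 : Equiv.swap (0 : Fin 3) 1 2 = 2 := by decide
  have e2 : Equiv.swap (0 : Fin 3) 2 1 = 1 := by decide
  have e3 : Equiv.swap (1 : Fin 3) 2 0 = 0 := by decide
  simp [e1, e2, e3]
  ring

/-- Alternatizing `α ⊗ β` over all six permutations gives `2! · 1!` times the shuffle sum;
antisymmetry of `α` makes the six terms agree in pairs, which cancels the factor 2. -/
theorem wedge_two_one_apply (α : V [⋀^Fin 2]→ₗ[ℝ] ℝ) (β : V [⋀^Fin 1]→ₗ[ℝ] ℝ) (v : Fin 3 → V) :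
    wedge α β v = α ![v 0, v 1] * β ![v 2] - α ![v 0, v 2] * β ![v 1]
      + α ![v 1, v 2] * β ![v 0] := by
  have key := congrArg (fun f => LinearMap.mul' ℝ ℝ (f (v ∘ finSumFinEquiv)))
    (MultilinearMap.domCoprod_alternization_eq α β)
  have hw : wedge α β v = LinearMap.mul' ℝ ℝ (α.domCoprod β (v ∘ finSumFinEquiv)) := rfl
  have swap : ∀ a b, α ![b, a] = -α ![a, b] := fun a b => by
    have := α.map_swap ![a, b] (i := 0) (j := 1) (by decide)
    rw [← this]
    congr 1
    ext i; fin_cases i <;> rfl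
  have h2 : ∀ w : Fin 2 → V, α w = α ![w 0, w 1] := fun w => by
    congr 1; ext i; fin_cases i <;> rfl
  have h1 : ∀ w : Fin 1 → V, β w = β ![w 0] := fun w => by
    congr 1; ext i; fin_cases i; rfl
  rw [MultilinearMap.alternatization_apply] at key
  simp only [AlternatingMap.smul_apply, map_nsmul, ← hw, map_sum,
    MultilinearMap.domDomCongr_apply, MultilinearMap.domCoprod_apply] at key
  -- Permutations of `Fin 2 ⊕ Fin 1` are traded for permutations of `Fin 3`; conjugation preserves
  -- the sign.
  rw [← (Equiv.permCongr (finSumFinEquiv (m := 2) (n := 1)).symm).sum_comp] at key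
  have sgn : ∀ σ : Equiv.Perm (Fin 3),
      Equiv.Perm.sign (Equiv.permCongr (finSumFinEquiv (m := 2) (n := 1)).symm σ)
        = Equiv.Perm.sign σ := fun σ => Equiv.Perm.sign_permCongr _ _
  have hT : ∀ σ : Equiv.Perm (Fin 3),
      LinearMap.mul' ℝ ℝ (Equiv.Perm.sign (Equiv.permCongr (finSumFinEquiv (m := 2) (n := 1)).symm σ)
        • ((α : MultilinearMap ℝ (fun _ : Fin 2 => V) ℝ) fun i₁ => (v ∘ finSumFinEquiv)
          (Equiv.permCongr (finSumFinEquiv (m := 2) (n := 1)).symm σ (Sum.inl i₁))) ⊗ₜ[ℝ]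
        ((β : MultilinearMap ℝ (fun _ : Fin 1 => V) ℝ) fun i₂ => (v ∘ finSumFinEquiv)
          (Equiv.permCongr (finSumFinEquiv (m := 2) (n := 1)).symm σ (Sum.inr i₂))))
      = ((Equiv.Perm.sign σ : ℤ) : ℝ) * (α ![v (σ 0), v (σ 1)] * β ![v (σ 2)]) := fun σ => by
    rw [sgn, Units.smul_def, map_zsmul, LinearMap.mul'_apply, zsmul_eq_mul]
    simp only [AlternatingMap.coe_multilinearMap]
    rw [h2, h1]
    simp [Equiv.permCongr_apply]
    rfl
  have key2 := (Finset.sum_congr rfl fun σ _ => (hT σ).symm).trans key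
  rw [sum_perm_fin_three fun i j k => α ![v i, v j] * β ![v k]] at key2
  rw [swap (v 0) (v 1), swap (v 1) (v 2), swap (v 0) (v 2)] at key2
  norm_num [Nat.factorial] at key2
  linarith

/-- The coefficient of a three-form with respect to the three-form `ρ`, computed in a basis. -/
def ratio (B : Module.Basis (Fin 3) ℝ V) (ρ : V [⋀^Fin 3]→ₗ[ℝ] ℝ) :
    (V [⋀^Fin 3]→ₗ[ℝ] ℝ) →ₗ[ℝ] ℝ where
  toFun η := η B / ρ B
  map_add' a b := by simp [add_div]
  map_smul' c a := by simp [mul_div_assoc]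

theorem ratio_apply (B : Module.Basis (Fin 3) ℝ V) (ρ η : V [⋀^Fin 3]→ₗ[ℝ] ℝ) :
    ratio B ρ η = η B / ρ B := rfl

theorem apply_basis_ne_zero (B : Module.Basis (Fin 3) ℝ V) {ρ : V [⋀^Fin 3]→ₗ[ℝ] ℝ}
    (hρ : ρ ≠ 0) : ρ B ≠ 0 := by
  intro h
  apply hρ
  rw [AlternatingMap.eq_smul_basis_det B ρ, h, zero_smul]

theorem ratio_smul_self (B : Module.Basis (Fin 3) ℝ V) {ρ : V [⋀^Fin 3]→ₗ[ℝ] ℝ}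
    (hρ : ρ ≠ 0) (η : V [⋀^Fin 3]→ₗ[ℝ] ℝ) : ratio B ρ η • ρ = η := by
  have h := apply_basis_ne_zero B hρ
  have h2 : ∀ f : V [⋀^Fin 3]→ₗ[ℝ] ℝ, f = f B • B.det := AlternatingMap.eq_smul_basis_det B
  conv_lhs => rw [h2 ρ, smul_smul, ← h2 ρ, ratio_apply, div_mul_cancel₀ _ h, ← h2]

/-- The one-form `θ` with `m = θ ⊗ ρ`. -/
def velocity (B : Module.Basis (Fin 3) ℝ V) (ρ : V [⋀^Fin 3]→ₗ[ℝ] ℝ) :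
    (V [⋀^Fin 1]→ₗ[ℝ] ℝ) ⊗[ℝ] (V [⋀^Fin 3]→ₗ[ℝ] ℝ) →ₗ[ℝ] (V [⋀^Fin 1]→ₗ[ℝ] ℝ) :=
  (TensorProduct.rid ℝ _).toLinearMap ∘ₗ (ratio B ρ).lTensor _

theorem velocity_tmul (B : Module.Basis (Fin 3) ℝ V) (ρ η : V [⋀^Fin 3]→ₗ[ℝ] ℝ)
    (θ : V [⋀^Fin 1]→ₗ[ℝ] ℝ) : velocity B ρ (θ ⊗ₜ η) = ratio B ρ η • θ := by
  simp [velocity]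

theorem velocity_tmul_self (B : Module.Basis (Fin 3) ℝ V) {ρ : V [⋀^Fin 3]→ₗ[ℝ] ℝ} (hρ : ρ ≠ 0)
    (m : (V [⋀^Fin 1]→ₗ[ℝ] ℝ) ⊗[ℝ] (V [⋀^Fin 3]→ₗ[ℝ] ℝ)) : velocity B ρ m ⊗ₜ[ℝ] ρ = m := by
  induction m with
  | zero => simp
  | tmul θ η => rw [velocity_tmul, TensorProduct.smul_tmul, ratio_smul_self B hρ]
  | add a b ha hb => rw [map_add, TensorProduct.add_tmul, ha, hb]

theorem contract_tmul (u : V) (θ : V [⋀^Fin 1]→ₗ[ℝ] ℝ) (η : V [⋀^Fin 3]→ₗ[ℝ] ℝ) :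
    contract u (θ ⊗ₜ[ℝ] η) = θ ![u] • η := by
  simp [contract]

/-- The basis `B'` on the right is arbitrary, so `velocity` does not depend on `B`. This lets
smoothness be checked in any chart. -/
theorem velocity_apply (B : Module.Basis (Fin 3) ℝ V) {ρ : V [⋀^Fin 3]→ₗ[ℝ] ℝ} (hρ : ρ ≠ 0)
    (m : (V [⋀^Fin 1]→ₗ[ℝ] ℝ) ⊗[ℝ] (V [⋀^Fin 3]→ₗ[ℝ] ℝ)) (u : V)
    (B' : Module.Basis (Fin 3) ℝ V) :
    velocity B ρ m ![u] = contract u m B' / ρ B' := by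
  have h := apply_basis_ne_zero B' hρ
  rw [← velocity_tmul_self B hρ m, contract_tmul, velocity_tmul_self B hρ m]
  simp [h]

theorem ratio_eq (B B' : Module.Basis (Fin 3) ℝ V) {ρ : V [⋀^Fin 3]→ₗ[ℝ] ℝ} (hρ : ρ ≠ 0)
    (η : V [⋀^Fin 3]→ₗ[ℝ] ℝ) : ratio B ρ η = η B' / ρ B' := by
  have h := apply_basis_ne_zero B' hρ
  have h2 := congrArg (fun f => f B') (ratio_smul_self B hρ η)
  simp at h2
  rw [← h2]; field_simp

theorem apply_one_eq_linear (β : V [⋀^Fin 1]→ₗ[ℝ] ℝ) (u : V) :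
    β ![u] = (AlternatingMap.ofSubsingleton ℝ V ℝ (0 : Fin 1)).symm β u := by
  rw [AlternatingMap.ofSubsingleton_symm_apply_apply]
  congr 1; ext i; fin_cases i; rfl

theorem apply_one_eq_sum (B : Module.Basis (Fin 3) ℝ V) (β : V [⋀^Fin 1]→ₗ[ℝ] ℝ) (u : V) :
    β ![u] = ∑ k, B.repr u k * β ![B k] := by
  simp only [apply_one_eq_linear]
  conv_lhs => rw [← B.sum_repr u, map_sum]
  simp

theorem apply_smul_one (β : V [⋀^Fin 1]→ₗ[ℝ] ℝ) (c : ℝ) (u : V) :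
    β ![c • u] = c * β ![u] := by
  rw [apply_one_eq_linear, apply_one_eq_linear, map_smul, smul_eq_mul]

theorem wedge_add_left (α α' : V [⋀^Fin 2]→ₗ[ℝ] ℝ) (β : V [⋀^Fin 1]→ₗ[ℝ] ℝ) :
    wedge (α + α') β = wedge α β + wedge α' β := by
  ext v
  change wedge (α + α') β v = wedge α β v + wedge α' β v
  simp only [wedge_two_one_apply, AlternatingMap.add_apply]; ring

theorem wedge_smul_left (c : ℝ) (α : V [⋀^Fin 2]→ₗ[ℝ] ℝ) (β : V [⋀^Fin 1]→ₗ[ℝ] ℝ) :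
    wedge (c • α) β = c • wedge α β := by
  ext v
  change wedge (c • α) β v = c * wedge α β v
  simp only [wedge_two_one_apply, AlternatingMap.smul_apply, smul_eq_mul]; ring

theorem wedge_sub_smul_right (α : V [⋀^Fin 2]→ₗ[ℝ] ℝ) (β β' : V [⋀^Fin 1]→ₗ[ℝ] ℝ) (c : ℝ) :
    wedge α (β - c • β') = wedge α β - c • wedge α β' := by
  ext v
  change wedge α (β - c • β') v = wedge α β v - c * wedge α β' v
  simp only [wedge_two_one_apply, AlternatingMap.smul_apply, AlternatingMap.sub_apply,
    smul_eq_mul]; ring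

/-- The determinant serves as the Levi-Civita symbol: the sign when `i` is a permutation, and zero
when two rows coincide. -/
theorem apply_fin_three (η : V [⋀^Fin 3]→ₗ[ℝ] ℝ) (e : Fin 3 → V) (i : Fin 3 → Fin 3) :
    η (fun a => e (i a)) = (Matrix.of fun a b => if i a = b then (1 : ℝ) else 0).det * η e := by
  by_cases hi : Function.Injective i
  · let σ : Equiv.Perm (Fin 3) := Equiv.ofBijective i (Finite.injective_iff_bijective.mp hi)
    have h1 : η (fun a => e (i a)) = Equiv.Perm.sign σ • η e := η.map_perm e σ
    have h2 : (Matrix.of fun a b => if i a = b then (1 : ℝ) else 0) = σ.toPEquiv.toMatrix := by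
      ext a b; simp [PEquiv.toMatrix_apply, σ, eq_comm, Equiv.toPEquiv_apply]
    rw [h1, h2, Matrix.det_permutation, Units.smul_def, zsmul_eq_mul]
  · have hi' := hi
    simp only [Function.Injective, not_forall] at hi
    obtain ⟨a, b, hab, hne⟩ := hi
    rw [η.map_eq_zero_of_eq _ (i := a) (j := b) (by simp [hab]) hne,
      Matrix.det_zero_of_row_eq hne (by ext; simp [hab]), zero_mul]

theorem apply_three (η : V [⋀^Fin 3]→ₗ[ℝ] ℝ) (e : Fin 3 → V) (i j k : Fin 3) :
    η ![e i, e j, e k] =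
      (Matrix.of fun a b => if ![i, j, k] a = b then (1 : ℝ) else 0).det * η e := by
  rw [← apply_fin_three]
  congr 1
  ext a; fin_cases a <;> rfl

theorem alternating_three_ext (B : Module.Basis (Fin 3) ℝ V) {η ζ : V [⋀^Fin 3]→ₗ[ℝ] ℝ}
    (h : η B = ζ B) : η = ζ := by
  rw [AlternatingMap.eq_smul_basis_det B η, h, ← AlternatingMap.eq_smul_basis_det B ζ]

theorem sum_sq_det_fin_three : ∑ i : Fin 3 → Fin 3,
    (Matrix.of fun a b => if i a = b then (1 : ℝ) else 0).det ^ 2 = 6 := by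
  -- Over the integers the sum of squared Levi-Civita symbols is decidable; the result is then cast
  -- to the reals.
  have h : ∑ i : Fin 3 → Fin 3,
      (Matrix.of fun a b => if i a = b then (1 : ℤ) else 0).det ^ 2 = 6 := by
    simp only [Matrix.det_fin_three, Matrix.of_apply]
    decide +kernel
  have h2 := congrArg (Int.cast : ℤ → ℝ) h
  push_cast at h2
  rw [← h2]
  refine Finset.sum_congr rfl fun i _ => ?_
  simp [Matrix.det_fin_three]

end Algebra

/-! ### Hodge star and musical isomorphism in dimension three -/

section Metric

variable [NormedAddCommGroup V] [InnerProductSpace ℝ V] [FiniteDimensional ℝ V]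

theorem hodgeStar_add {k m : ℕ} (vol : V [⋀^Fin (k + m)]→ₗ[ℝ] ℝ) (α β : V [⋀^Fin k]→ₗ[ℝ] ℝ) :
    hodgeStar vol (α + β) = hodgeStar vol α + hodgeStar vol β := by
  simp [hodgeStar, add_smul, Finset.sum_add_distrib]

theorem hodgeStar_smul {k m : ℕ} (vol : V [⋀^Fin (k + m)]→ₗ[ℝ] ℝ) (c : ℝ)
    (α : V [⋀^Fin k]→ₗ[ℝ] ℝ) :
    hodgeStar vol (c • α) = c • hodgeStar vol α := by
  simp only [hodgeStar, AlternatingMap.smul_apply, smul_eq_mul, mul_smul, ← Finset.smul_sum]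
  rw [smul_comm]

theorem inner_sharp (θ : V [⋀^Fin 1]→ₗ[ℝ] ℝ) (w : V) : inner ℝ (sharp θ) w = θ ![w] := by
  have : CompleteSpace V := FiniteDimensional.complete ℝ V
  rw [sharp, InnerProductSpace.toDual_symm_apply]
  simp
  congr 1; ext i; fin_cases i; rfl

theorem sharp_add (α β : V [⋀^Fin 1]→ₗ[ℝ] ℝ) : sharp (α + β) = sharp α + sharp β := by
  refine ext_inner_right ℝ fun w => ?_
  simp [inner_add_left, inner_sharp]

theorem sharp_smul (c : ℝ) (α : V [⋀^Fin 1]→ₗ[ℝ] ℝ) : sharp (c • α) = c • sharp α := by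
  refine ext_inner_right ℝ fun w => ?_
  simp [inner_smul_left, inner_sharp]

variable [Fact (Module.finrank ℝ V = 3)]

/-- The standard orthonormal basis, indexed by `Fin 3`. -/
def onb3 (V : Type*) [NormedAddCommGroup V] [InnerProductSpace ℝ V] [FiniteDimensional ℝ V]
    [h : Fact (Module.finrank ℝ V = 3)] : OrthonormalBasis (Fin 3) ℝ V :=
  (stdOrthonormalBasis ℝ V).reindex (finCongr h.out)

theorem hodgeStar_apply {k m : ℕ} (vol : V [⋀^Fin (k + m)]→ₗ[ℝ] ℝ)
    (α : V [⋀^Fin k]→ₗ[ℝ] ℝ) (w : Fin m → V) :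
    hodgeStar vol α w = ((k.factorial : ℝ)⁻¹) * ∑ i : Fin k → Fin 3,
      α (fun a => onb3 V (i a)) * vol (Fin.append (fun a => onb3 V (i a)) w) := by
  let ev : (V [⋀^Fin m]→ₗ[ℝ] ℝ) →+ ℝ :=
    { toFun := fun η => η w, map_zero' := rfl, map_add' := fun _ _ => rfl }
  rw [hodgeStar, AlternatingMap.smul_apply, smul_eq_mul]
  change _ * ev _ = _
  rw [map_sum]
  congr 1
  refine Fintype.sum_equiv ((Equiv.refl _).arrowCongr
    (finCongr (Fact.out : Module.finrank ℝ V = 3))) _ _ fun i => ?_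
  simp [onb3, ev, fillLeft]

theorem volumeForm_onb3_mul_self (o : Orientation ℝ V (Fin 3)) :
    o.volumeForm (onb3 V) * o.volumeForm (onb3 V) = 1 := by
  have h := o.abs_volumeForm_apply_of_orthonormal (onb3 V)
  rw [← abs_mul_abs_self, h, one_mul]

/-- Only the six permutations contribute to the star, cancelling `1/3!`. The orthonormal basis may
be negatively oriented, but the volume form enters squared. -/
theorem hodgeStar_three_smul_volumeForm (o : Orientation ℝ V (Fin 3)) (η : V [⋀^Fin 3]→ₗ[ℝ] ℝ) :
    hodgeStar (k := 3) (m := 0) o.volumeForm η ![] • o.volumeForm = η := by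
  refine alternating_three_ext (onb3 V).toBasis ?_
  have hs := volumeForm_onb3_mul_self o
  have h1 : ∀ i : Fin 3 → Fin 3, o.volumeForm
      (Fin.append (m := 3) (n := 0) (fun a => onb3 V (i a)) ![]) =
        o.volumeForm (fun a => onb3 V (i a)) := fun i => by
    congr 1
    ext a; fin_cases a <;> rfl
  rw [AlternatingMap.smul_apply, hodgeStar_apply]
  simp only [h1, smul_eq_mul, OrthonormalBasis.coe_toBasis]
  have h2 : ∀ i : Fin 3 → Fin 3, η (fun a => onb3 V (i a)) *
      o.volumeForm (fun a => onb3 V (i a)) =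
        (Matrix.of fun a b => if i a = b then (1 : ℝ) else 0).det ^ 2 *
          (η (onb3 V) * o.volumeForm (onb3 V)) := fun i => by
    rw [apply_fin_three η, apply_fin_three o.volumeForm]; ring
  rw [Finset.sum_congr rfl fun i _ => h2 i, ← Finset.sum_mul, sum_sq_det_fin_three]
  have h6 : ((Nat.factorial 3 : ℕ) : ℝ) = 6 := by norm_num [Nat.factorial]
  rw [h6]
  linear_combination η (onb3 V) * hs

theorem hodgeStar_two_apply (vol : V [⋀^Fin 3]→ₗ[ℝ] ℝ) (α : V [⋀^Fin 2]→ₗ[ℝ] ℝ) (w : V) :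
    hodgeStar (k := 2) (m := 1) vol α ![w] =
      2⁻¹ * ∑ i, ∑ j, α ![onb3 V i, onb3 V j] * vol ![onb3 V i, onb3 V j, w] := by
  rw [hodgeStar_apply, ← (finTwoArrowEquiv (Fin 3)).symm.sum_comp, ← Finset.univ_product_univ,
    Finset.sum_product]
  norm_num [Nat.factorial]
  refine Finset.sum_congr rfl fun i _ => Finset.sum_congr rfl fun j _ => ?_
  congr 1
  · congr 1
    ext a; fin_cases a <;> rfl
  · congr 1
    ext a; fin_cases a <;> rfl

theorem apply_sharp (α β : V [⋀^Fin 1]→ₗ[ℝ] ℝ) :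
    β ![sharp α] = ∑ k, α ![onb3 V k] * β ![onb3 V k] := by
  rw [apply_one_eq_sum (onb3 V).toBasis]
  refine Finset.sum_congr rfl fun k _ => ?_
  rw [OrthonormalBasis.coe_toBasis_repr_apply, OrthonormalBasis.repr_apply_apply, real_inner_comm,
    inner_sharp, OrthonormalBasis.coe_toBasis]

theorem wedge_eq_apply_sharp_smul_volumeForm (o : Orientation ℝ V (Fin 3))
    (α : V [⋀^Fin 2]→ₗ[ℝ] ℝ) (β : V [⋀^Fin 1]→ₗ[ℝ] ℝ) :
    wedge α β = β ![sharp (hodgeStar (k := 2) (m := 1) o.volumeForm α)] • o.volumeForm := by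
  refine alternating_three_ext (onb3 V).toBasis ?_
  have hs := volumeForm_onb3_mul_self o
  have swap : ∀ a b, α ![b, a] = -α ![a, b] := fun a b => by
    have := α.map_swap ![a, b] (i := 0) (j := 1) (by decide)
    rw [← this]
    congr 1
    ext i; fin_cases i <;> rfl
  rw [wedge_two_one_apply, AlternatingMap.smul_apply, apply_sharp]
  simp only [hodgeStar_two_apply, OrthonormalBasis.coe_toBasis, smul_eq_mul,
    apply_three o.volumeForm (onb3 V), Fin.sum_univ_three, Matrix.det_fin_three, Matrix.of_apply]
  simp
  rw [swap (onb3 V 0) (onb3 V 1), swap (onb3 V 0) (onb3 V 2), swap (onb3 V 1) (onb3 V 2)]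
  linear_combination (-(α ![onb3 V 0, onb3 V 1] * β ![onb3 V 2] -
    α ![onb3 V 0, onb3 V 2] * β ![onb3 V 1] + α ![onb3 V 1, onb3 V 2] * β ![onb3 V 0])) * hs

end Metric
-- The volume form is the determinant in an orthonormal basis oriented by `o`, and positive
-- determinant means equal orientation.
theorem volumeForm_pos_iff {V : Type*} [NormedAddCommGroup V] [InnerProductSpace ℝ V]
    [Fact (Module.finrank ℝ V = 3)] (o : Orientation ℝ V (Fin 3)) (B : Module.Basis (Fin 3) ℝ V) :
    0 < o.volumeForm B ↔ o = B.orientation := by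
  have h3 : 0 < 3 := by norm_num
  have ho := o.finOrthonormalBasis_orientation h3 (Fact.out : Module.finrank ℝ V = 3)
  rw [o.volumeForm_robust _ ho, ← Module.Basis.orientation_eq_iff_det_pos, ho]

end Pointwise
-- Smoothness of quotients by the density, and the tangent map
section Smoothness

variable {M : Type*} [TopologicalSpace M] [ChartedSpace E3 M]

theorem contMDiff_of_contMDiffOn_charts {f : M → ℝ}
    (h : ∀ x₀, ContMDiffOn (𝓡 3) 𝓘(ℝ) ∞ f (chartAt E3 x₀).source) :
    ContMDiff (𝓡 3) 𝓘(ℝ) ∞ f := fun x =>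
  (h x).contMDiffAt ((chartAt E3 x).open_source.mem_nhds (mem_chart_source E3 x))

variable [IsManifold (𝓡 3) ∞ M]

theorem coordBasis_apply (x₀ x : M) (hx : x ∈ (chartAt E3 x₀).source) (i : Fin 3) :
    coordBasis x₀ x hx i = coordVec x₀ x (EuclideanSpace.basisFun (Fin 3) ℝ i) := by
  simp only [coordBasis, coordVec, Module.Basis.map_apply, OrthonormalBasis.coe_toBasis]
  rw [Trivialization.symmL_apply _ hx]
  rfl

theorem coe_coordBasis (x₀ x : M) (hx : x ∈ (chartAt E3 x₀).source) :
    ⇑(coordBasis x₀ x hx) = fun i => coordVec x₀ x (EuclideanSpace.basisFun (Fin 3) ℝ i) :=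
  funext (coordBasis_apply x₀ x hx)

theorem coordBasis_repr_apply (x₀ x : M) (hx : x ∈ (chartAt E3 x₀).source)
    (u : TangentSpace (𝓡 3) x) (i : Fin 3) : (coordBasis x₀ x hx).repr u i =
      (trivializationAt E3 (TangentSpace (𝓡 3)) x₀ ⟨x, u⟩).2 i := by
  simp [coordBasis]
  rfl

theorem apply_chart_component_ne_zero (ρ : DForm M 3) (hρ : ∀ x, ρ.1 x ≠ 0) (x₀ x : M)
    (hx : x ∈ (chartAt E3 x₀).source) :
    ρ.1 x (fun i => coordVec x₀ x (EuclideanSpace.basisFun (Fin 3) ℝ i)) ≠ 0 := by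
  rw [← coe_coordBasis x₀ x hx]
  exact apply_basis_ne_zero _ (hρ x)

/-- The coordinate basis at `x` of the preferred chart at `x`. -/
def frameAt (x : M) : Module.Basis (Fin 3) ℝ (TangentSpace (𝓡 3) x) :=
  coordBasis x x (mem_chart_source E3 x)

/-- `frameAt x` need not vary continuously with `x`, but the ratio is independent of the frame: in a
fixed chart it is a quotient of smooth components. -/
theorem contMDiff_ratio (ρ η : DForm M 3) (hρ : ∀ x, ρ.1 x ≠ 0) :
    ContMDiff (𝓡 3) 𝓘(ℝ) ∞ (fun x => ratio (frameAt x) (ρ.1 x) (η.1 x)) :=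
  contMDiff_of_contMDiffOn_charts fun x₀ =>
    ((η.2 x₀ _).div₀ (ρ.2 x₀ (EuclideanSpace.basisFun (Fin 3) ℝ))
      (apply_chart_component_ne_zero ρ hρ x₀)).congr fun x hx => by
        rw [ratio_eq _ (coordBasis x₀ x hx) (hρ x), coe_coordBasis]
        rfl

theorem fin_one_eq {α : Type*} (v : Fin 1 → α) : v = ![v 0] := by
  ext i; fin_cases i; rfl

/-- The velocity one-form `θ` of `m = θ ⊗ ρ`. -/
def velocityForm (m : OneFormDensity M) (ρ : DForm M 3) (hρ : ∀ x, ρ.1 x ≠ 0) : DForm M 1 :=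
  ⟨fun x => velocity (frameAt x) (ρ.1 x) (m.1 x), fun x₀ v =>
    ((m.2 x₀ (v 0) _).div₀ (ρ.2 x₀ (EuclideanSpace.basisFun (Fin 3) ℝ))
      (apply_chart_component_ne_zero ρ hρ x₀)).congr fun x hx => by
        rw [fin_one_eq fun i => coordVec x₀ x (v i),
          velocity_apply _ (hρ x) _ _ (coordBasis x₀ x hx), coe_coordBasis]
        rfl⟩

/-- The product of a smooth function and a differential form. -/
def smulForm {k : ℕ} (f : M → ℝ) (hf : ContMDiff (𝓡 3) 𝓘(ℝ) ∞ f) (η : DForm M k) : DForm M k :=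
  ⟨fun x => f x • η.1 x, fun x₀ v => hf.contMDiffOn.mul (η.2 x₀ v)⟩

/-- The tangent map of `Φ` at `(θ ⊗ ρ, ρ)`. -/
def tangentPhi (θ : DForm M 1) (ρ : DForm M 3) (hρ : ∀ x, ρ.1 x ≠ 0) :
    LieSDual M →ₗ[ℝ] Vel M where
  toFun δ := (velocityForm δ.1 ρ hρ - smulForm _ (contMDiff_ratio ρ δ.2 hρ) θ, δ.2)
  map_add' a b := by
    refine Prod.ext (Subtype.ext (funext fun x => ?_)) rfl
    change velocity _ _ (a.1.1 x + b.1.1 x) - ratio _ _ (a.2.1 x + b.2.1 x) • θ.1 x =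
      (velocity _ _ (a.1.1 x) - ratio _ _ (a.2.1 x) • θ.1 x) +
      (velocity _ _ (b.1.1 x) - ratio _ _ (b.2.1 x) • θ.1 x)
    rw [map_add, map_add, add_smul]
    abel
  map_smul' c a := by
    refine Prod.ext (Subtype.ext (funext fun x => ?_)) rfl
    change velocity _ _ (c • a.1.1 x) - ratio _ _ (c • a.2.1 x) • θ.1 x =
      c • (velocity _ _ (a.1.1 x) - ratio _ _ (a.2.1 x) • θ.1 x)
    rw [map_smul, map_smul, smul_sub, smul_assoc]

theorem tangentPhi_fst_apply (θ : DForm M 1) (ρ : DForm M 3) (hρ : ∀ x, ρ.1 x ≠ 0)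
    (δ : LieSDual M) (x : M) : (tangentPhi θ ρ hρ δ).1.1 x =
      velocity (frameAt x) (ρ.1 x) (δ.1.1 x) -
        ratio (frameAt x) (ρ.1 x) (δ.2.1 x) • θ.1 x := rfl

/-- `velocityForm` supplies a witness, so the dummy branch is not taken. The chosen form is used
below only through this equation, which determines it. -/
theorem Phi_spec (p : LieSDual M) (hp : ∀ x, p.2.1 x ≠ 0) :
    (Phi p).2 = p.2 ∧ ∀ x, p.1.1 x = (Phi p).1.1 x ⊗ₜ[ℝ] p.2.1 x := by
  have h : (∀ x, p.2.1 x ≠ 0) ∧ ∃ θ : DForm M 1, ∀ x, p.1.1 x = θ.1 x ⊗ₜ[ℝ] p.2.1 x :=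
    ⟨hp, velocityForm p.1 p.2 hp, fun x => (velocity_tmul_self _ (hp x) _).symm⟩
  rw [Phi, dif_pos h]
  exact ⟨rfl, h.2.choose_spec⟩

/-- Since `ρ + tη = (1 + t η/ρ) ρ` and compactness bounds `|η/ρ|` by some `C`, all `t` with `|t| C <
1` work simultaneously at every point. -/
theorem eventually_add_smul_ne_zero [CompactSpace M] (ρ η : DForm M 3) (hρ : ∀ x, ρ.1 x ≠ 0) :
    ∀ᶠ t : ℝ in 𝓝 0, ∀ x, (ρ + t • η).1 x ≠ 0 := by
  obtain ⟨C, hC⟩ := isCompact_univ.exists_bound_of_continuousOn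
    (contMDiff_ratio ρ η hρ).continuous.continuousOn
  have h0 : Filter.Tendsto (fun t : ℝ => |t| * C) (𝓝 0) (𝓝 0) := by
    have : Continuous fun t : ℝ => |t| * C := by fun_prop
    simpa using this.tendsto 0
  filter_upwards [h0.eventually (gt_mem_nhds one_pos)] with t ht x hx
  change ρ.1 x + t • η.1 x = 0 at hx
  rw [← ratio_smul_self (frameAt x) (hρ x) (η.1 x), smul_smul] at hx
  nth_rewrite 1 [← one_smul ℝ (ρ.1 x)] at hx
  rw [← add_smul, smul_eq_zero, or_iff_left (hρ x)] at hx
  have h1 := hC x (mem_univ x)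
  rw [Real.norm_eq_abs] at h1
  have h2 := mul_le_mul_of_nonneg_left h1 (abs_nonneg t)
  rw [← abs_mul, eq_neg_of_add_eq_zero_right hx] at h2
  norm_num at h2
  linarith

theorem isTangentMapPhi_tangentPhi [CompactSpace M] (m : OneFormDensity M) (θ : DForm M 1)
    (ρ : DForm M 3) (hρ : ∀ x, ρ.1 x ≠ 0) (hm : ∀ x, m.1 x = θ.1 x ⊗ₜ[ℝ] ρ.1 x) :
    IsTangentMapPhi (m, ρ) (tangentPhi θ ρ hρ) := by
  intro δ x
  have hev := eventually_add_smul_ne_zero ρ δ.2 hρ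
  constructor
  · intro v
    have hB := apply_basis_ne_zero (frameAt x) (hρ x)
    obtain ⟨u, rfl⟩ : ∃ u, v = ![u] := ⟨v 0, fin_one_eq v⟩
    -- Near `t = 0` the perturbed density vanishes nowhere, so `Phi` is not the dummy value;
    -- contracting its defining equation with `u` and evaluating on the frame gives an explicit
    -- quotient.
    have hval : ∀ᶠ t : ℝ in 𝓝 0, (Phi ((m, ρ) + t • δ)).1.1 x ![u] =
        (θ.1 x ![u] * ρ.1 x (frameAt x) + t * contract u (δ.1.1 x) (frameAt x)) /
          (ρ.1 x (frameAt x) + t * δ.2.1 x (frameAt x)) := by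
      filter_upwards [hev] with t ht
      have h1 := (Phi_spec ((m, ρ) + t • δ) ht).2 x
      have h2 := apply_basis_ne_zero (frameAt x) (ht x)
      have h3 := congrArg (fun z => contract u z (frameAt x)) h1
      change contract u (m.1 x + t • δ.1.1 x) (frameAt x) =
        contract u (_ ⊗ₜ[ℝ] (ρ.1 x + t • δ.2.1 x)) (frameAt x) at h3
      change (ρ.1 x + t • δ.2.1 x) (frameAt x) ≠ 0 at h2
      rw [map_add, map_smul, hm x, contract_tmul, contract_tmul] at h3
      simp only [AlternatingMap.add_apply, AlternatingMap.smul_apply, smul_eq_mul] at h2 h3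
      rw [h3]
      field_simp
    refine HasDerivAt.congr_of_eventuallyEq ?_ hval
    have hd := (((hasDerivAt_id (0 : ℝ)).mul_const (contract u (δ.1.1 x) (frameAt x))).const_add
      (θ.1 x ![u] * ρ.1 x (frameAt x))).div
      (((hasDerivAt_id (0 : ℝ)).mul_const (δ.2.1 x (frameAt x))).const_add
        (ρ.1 x (frameAt x))) (by simpa using hB)
    refine hd.congr_deriv ?_
    rw [tangentPhi_fst_apply, AlternatingMap.sub_apply, AlternatingMap.smul_apply,
      velocity_apply _ (hρ x) _ _ (frameAt x), ratio_apply]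
    simp
    field_simp
  · intro v
    have hval : ∀ᶠ t : ℝ in 𝓝 0, (Phi ((m, ρ) + t • δ)).2.1 x v =
        ρ.1 x v + t * δ.2.1 x v := by
      filter_upwards [hev] with t ht
      rw [(Phi_spec ((m, ρ) + t • δ) ht).1]
      rfl
    refine HasDerivAt.congr_of_eventuallyEq ?_ hval
    simpa [tangentPhi] using
      ((hasDerivAt_id (0 : ℝ)).mul_const (δ.2.1 x v)).const_add (ρ.1 x v)

theorem contMDiff_section_of_repr (X : ∀ x : M, TangentSpace (𝓡 3) x)
    (c : M → Fin 3 → M → ℝ)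
    (hc : ∀ x₀ k, ContMDiffOn (𝓡 3) 𝓘(ℝ) ∞ (c x₀ k) (chartAt E3 x₀).source)
    (hX : ∀ x₀ x (hx : x ∈ (chartAt E3 x₀).source) k,
      (coordBasis x₀ x hx).repr (X x) k = c x₀ k x) :
    ContMDiff (𝓡 3) ((𝓡 3).prod 𝓘(ℝ, E3)) ∞ (fun x => TotalSpace.mk' E3 x (X x)) := by
  intro x₀
  rw [contMDiffAt_section]
  have hs : (chartAt E3 x₀).source ∈ 𝓝 x₀ :=
    (chartAt E3 x₀).open_source.mem_nhds (mem_chart_source E3 x₀)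
  have h1 : ContMDiffAt (𝓡 3) 𝓘(ℝ, Fin 3 → ℝ) ∞ (fun x k => c x₀ k x) x₀ :=
    contMDiffAt_pi_space.2 fun k => (hc x₀ k).contMDiffAt hs
  have h2 : ContMDiffAt (𝓡 3) 𝓘(ℝ, E3) ∞
      (fun x => (EuclideanSpace.equiv (Fin 3) ℝ).symm fun k => c x₀ k x) x₀ :=
    (EuclideanSpace.equiv (Fin 3) ℝ).symm.contDiff.contMDiff.contMDiffAt.comp x₀ h1
  refine h2.congr_of_eventuallyEq ?_
  filter_upwards [hs] with x hx
  ext k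
  rw [← coordBasis_repr_apply x₀ x hx, hX]
  rfl

theorem contMDiffOn_coordVec (x₀ : M) (v : E3) :
    ContMDiffOn (𝓡 3) ((𝓡 3).prod 𝓘(ℝ, E3)) ∞ (fun x => TotalSpace.mk' E3 x (coordVec x₀ x v))
      (chartAt E3 x₀).source := by
  have := (trivializationAt E3 (TangentSpace (𝓡 3)) x₀).contMDiffOn_section_baseSet_iff
    (IB := 𝓡 3) (n := ∞) (s := fun x => coordVec x₀ x v)
  refine this.2 (contMDiffOn_const (c := v) |>.congr fun x hx => ?_)
  rw [coordVec, Trivialization.symmL_apply _ hx]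
  exact congrArg Prod.snd ((trivializationAt E3 (TangentSpace (𝓡 3)) x₀).apply_mk_symm hx v)

end Smoothness

/-! ### Linearity and positivity of the integral -/

section Integral

variable {M : Type*} [TopologicalSpace M] [ChartedSpace E3 M] [IsManifold (𝓡 3) ∞ M]
  (o : MOrientation M)

theorem chartDensity_sub (η ζ : DForm M 3) (x₀ x : M) :
    chartDensity o (η - ζ).1 x₀ x = chartDensity o η.1 x₀ x - chartDensity o ζ.1 x₀ x := by
  unfold chartDensity
  split_ifs
  · exact mul_sub _ (η.1 x _) (ζ.1 x _)
  · exact mul_sub _ (η.1 x _) (ζ.1 x _)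
  · simp

theorem continuousOn_chartDensity (η : DForm M 3) (x₀ : M) :
    ContinuousOn (chartDensity o η.1 x₀) (chartAt E3 x₀).source := by
  classical
  have h1 : Continuous fun x : (chartAt E3 x₀).source =>
      (if o.orient x = (coordBasis x₀ x x.2).orientation then 1 else -1 : ℝ) :=
    ((o.locallyConstant x₀).comp fun p : Prop => (if p then 1 else -1 : ℝ)).continuous
  have h2 := continuousOn_iff_continuous_domRestrict.1
    (η.2 x₀ (EuclideanSpace.basisFun (Fin 3) ℝ)).continuousOn
  rw [continuousOn_iff_continuous_domRestrict]
  refine (h1.mul h2).congr fun x => ?_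
  rw [Set.domRestrict_apply, chartDensity, dif_pos x.2, coe_coordBasis]
  simp only [Pi.mul_apply, Set.domRestrict_apply]

variable [T2Space M] [CompactSpace M]

theorem tsupport_chartPartition_subset (x₀ : M) :
    tsupport (chartPartition M x₀) ⊆ (chartAt E3 x₀).source :=
  (SmoothPartitionOfUnity.exists_isSubordinate_chartAt_source (𝓡 3) M).choose_spec x₀

/-- The contribution of the chart around `x₀` to the integral of a three-form. -/
def chartIntegrand (η : ∀ x : M, TangentSpace (𝓡 3) x [⋀^Fin 3]→ₗ[ℝ] ℝ) (x₀ : M) (y : E3) : ℝ :=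
  chartPartition M x₀ ((chartAt E3 x₀).symm y) * chartDensity o η x₀ ((chartAt E3 x₀).symm y)

theorem integralM_eq (η : ∀ x : M, TangentSpace (𝓡 3) x [⋀^Fin 3]→ₗ[ℝ] ℝ) :
    integralM o η = ∑ᶠ x₀ : M, ∫ y in (chartAt E3 x₀).target, chartIntegrand o η x₀ y := rfl

theorem continuousOn_chartIntegrand (η : DForm M 3) (x₀ : M) :
    ContinuousOn (chartIntegrand o η.1 x₀) (chartAt E3 x₀).target :=
  ((chartPartition M x₀).contMDiff.continuous.comp_continuousOn
    (chartAt E3 x₀).continuousOn_symm).mul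
    ((continuousOn_chartDensity o η x₀).comp (chartAt E3 x₀).continuousOn_symm
      (chartAt E3 x₀).mapsTo_symm)

/-- The integrand is continuous on the chart target and vanishes off the image of the support of the
partition function, which is compact. -/
theorem integrableOn_chartIntegrand (η : DForm M 3) (x₀ : M) :
    IntegrableOn (chartIntegrand o η.1 x₀) (chartAt E3 x₀).target := by
  have hsub := tsupport_chartPartition_subset x₀
  have hK : IsCompact (chartAt E3 x₀ '' tsupport (chartPartition M x₀)) :=
    (isClosed_tsupport _).isCompact.image_of_continuousOn
      ((chartAt E3 x₀).continuousOn.mono hsub)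
  have hKt : chartAt E3 x₀ '' tsupport (chartPartition M x₀) ⊆ (chartAt E3 x₀).target := by
    rintro _ ⟨x, hx, rfl⟩
    exact (chartAt E3 x₀).map_source (hsub hx)
  refine (((continuousOn_chartIntegrand o η x₀).mono hKt).integrableOn_compact
    hK).of_forall_sdiff_eq_zero (chartAt E3 x₀).open_target.measurableSet fun y hy => ?_
  have : (chartAt E3 x₀).symm y ∉ tsupport (chartPartition M x₀) := fun h =>
    hy.2 ⟨_, h, (chartAt E3 x₀).right_inv hy.1⟩
  rw [chartIntegrand, image_eq_zero_of_notMem_tsupport this, zero_mul]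

theorem finite_support_chartIntegral (η : ∀ x : M, TangentSpace (𝓡 3) x [⋀^Fin 3]→ₗ[ℝ] ℝ) :
    (Function.support fun x₀ : M =>
      ∫ y in (chartAt E3 x₀).target, chartIntegrand o η x₀ y).Finite := by
  refine ((chartPartition M).locallyFinite.finite_nonempty_of_compact).subset fun x₀ h => ?_
  by_contra hne
  have h0 : ∀ x, chartPartition M x₀ x = 0 := by
    simpa [Function.support, Set.not_nonempty_iff_eq_empty, Set.eq_empty_iff_forall_notMem]
      using hne
  exact h (by simp [chartIntegrand, h0])

theorem integralM_sub (η ζ : DForm M 3) :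
    integralM o (η - ζ).1 = integralM o η.1 - integralM o ζ.1 := by
  simp only [integralM_eq]
  rw [← finsum_sub_distrib (finite_support_chartIntegral o η.1)
    (finite_support_chartIntegral o ζ.1)]
  refine finsum_congr fun x₀ => ?_
  rw [← integral_sub (integrableOn_chartIntegrand o η x₀) (integrableOn_chartIntegrand o ζ x₀)]
  congr 1
  ext y
  rw [chartIntegrand, chartDensity_sub, mul_sub]
  rfl

/-- A nonnegative three-form with vanishing integral vanishes. -/
theorem eq_zero_of_integralM_eq_zero (η : DForm M 3)
    (hpos : ∀ x₀, ∀ x ∈ (chartAt E3 x₀).source, 0 ≤ chartDensity o η.1 x₀ x)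
    (hint : integralM o η.1 = 0) (x : M) : η.1 x = 0 := by
  have hnn : ∀ x₀, ∀ y ∈ (chartAt E3 x₀).target, 0 ≤ chartIntegrand o η.1 x₀ y :=
    fun x₀ y hy => mul_nonneg ((chartPartition M).nonneg x₀ _)
      (hpos x₀ _ ((chartAt E3 x₀).map_target hy))
  have hnI : ∀ x₀, 0 ≤ ∫ y in (chartAt E3 x₀).target, chartIntegrand o η.1 x₀ y := fun x₀ =>
    setIntegral_nonneg (chartAt E3 x₀).open_target.measurableSet (hnn x₀)
  have hz : ∀ x₀, ∫ y in (chartAt E3 x₀).target, chartIntegrand o η.1 x₀ y = 0 := by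
    intro x₀
    have hfin := finite_support_chartIntegral o η.1
    rw [integralM_eq, finsum_eq_sum _ hfin, Finset.sum_eq_zero_iff_of_nonneg
      fun x₀ _ => hnI x₀] at hint
    by_contra hne
    exact hne (hint x₀ (hfin.mem_toFinset.2 hne))
  obtain ⟨x₀, hx₀⟩ : ∃ x₀, chartPartition M x₀ x ≠ 0 := by
    by_contra! h
    have := (chartPartition M).sum_eq_one (mem_univ x)
    simp [h] at this
  have hx : x ∈ (chartAt E3 x₀).source :=
    tsupport_chartPartition_subset x₀ (subset_tsupport _ hx₀)
  -- The chart contributions are nonnegative with sum zero, so each vanishes; continuity upgrades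
  -- vanishing almost everywhere to vanishing on the open chart target.
  have hae := (setIntegral_eq_zero_iff_of_nonneg_ae
    ((ae_restrict_iff' (chartAt E3 x₀).open_target.measurableSet).2 (ae_of_all _ (hnn x₀)))
    (integrableOn_chartIntegrand o η x₀)).1 (hz x₀)
  have hEq := Measure.eqOn_open_of_ae_eq hae (chartAt E3 x₀).open_target
    (continuousOn_chartIntegrand o η x₀) continuousOn_const ((chartAt E3 x₀).map_source hx)
  rw [chartIntegrand, (chartAt E3 x₀).left_inv hx] at hEq
  have hd : chartDensity o η.1 x₀ x = 0 := (mul_eq_zero.1 hEq).resolve_left hx₀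
  rw [chartDensity, dif_pos hx] at hd
  by_contra hne
  refine (mul_ne_zero ?_ (apply_basis_ne_zero (coordBasis x₀ x hx) hne)) hd
  split_ifs <;> norm_num

end Integral

/-! ### The dual map and the duality identity -/

section Dual

variable {M : Type*} [TopologicalSpace M] [ChartedSpace E3 M] [IsManifold (𝓡 3) ∞ M]

theorem contMDiffOn_apply_pair (e : DForm M 2) (x₀ : M) (u v : E3) :
    ContMDiffOn (𝓡 3) 𝓘(ℝ) ∞ (fun x => e.1 x ![coordVec x₀ x u, coordVec x₀ x v])
      (chartAt E3 x₀).source :=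
  (e.2 x₀ ![u, v]).congr fun x _ => by
    congr 1
    ext i : 1
    fin_cases i <;> rfl

theorem contMDiffOn_apply_single (θ : DForm M 1) (x₀ : M) (u : E3) :
    ContMDiffOn (𝓡 3) 𝓘(ℝ) ∞ (fun x => θ.1 x ![coordVec x₀ x u]) (chartAt E3 x₀).source :=
  (θ.2 x₀ ![u]).congr fun x _ => by
    congr 1
    ext i : 1
    fin_cases i; rfl

/-- The wedge product of a smooth two-form and a smooth one-form. -/
def wedgeForm (e : DForm M 2) (θ : DForm M 1) : DForm M 3 :=
  ⟨fun x => wedge (e.1 x) (θ.1 x), fun x₀ v => by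
    have h := (((contMDiffOn_apply_pair e x₀ (v 0) (v 1)).mul (contMDiffOn_apply_single θ x₀ (v 2))).sub
      ((contMDiffOn_apply_pair e x₀ (v 0) (v 2)).mul (contMDiffOn_apply_single θ x₀ (v 1)))).add
      ((contMDiffOn_apply_pair e x₀ (v 1) (v 2)).mul (contMDiffOn_apply_single θ x₀ (v 0)))
    exact h.congr fun x _ => wedge_two_one_apply _ _ _⟩

variable [RiemannianBundle (fun x : M => TangentSpace (𝓡 3) x)] (o : MOrientation M)

theorem star3_smul_volumeForm (x : M) (η : TangentSpace (𝓡 3) x [⋀^Fin 3]→ₗ[ℝ] ℝ) :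
    star3 o x η • (o.orient x).volumeForm = η :=
  hodgeStar_three_smul_volumeForm _ _

theorem star3_ne_zero (x : M) {η : TangentSpace (𝓡 3) x [⋀^Fin 3]→ₗ[ℝ] ℝ} (hη : η ≠ 0) :
    star3 o x η ≠ 0 := by
  intro h
  rw [← star3_smul_volumeForm o x η, h, zero_smul] at hη
  exact hη rfl

theorem ratio_eq_star3_div (x : M) {ρ : TangentSpace (𝓡 3) x [⋀^Fin 3]→ₗ[ℝ] ℝ} (hρ : ρ ≠ 0)
    (η : TangentSpace (𝓡 3) x [⋀^Fin 3]→ₗ[ℝ] ℝ) :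
    ratio (frameAt x) ρ η = star3 o x η / star3 o x ρ := by
  have h1 := apply_basis_ne_zero (frameAt x) hρ
  have h2 := star3_ne_zero o x hρ
  have e1 := congrArg (fun f => f (frameAt x)) (star3_smul_volumeForm o x ρ)
  have e2 := congrArg (fun f => f (frameAt x)) (star3_smul_volumeForm o x η)
  simp only [AlternatingMap.smul_apply, smul_eq_mul] at e1 e2
  rw [ratio_apply, div_eq_div_iff h1 h2, ← e1, ← e2]
  ring

/-- The vector field `(⋆e)^♯ / ⋆ρ`. -/
def dualVector (e : DForm M 2) (ρ : DForm M 3) (x : M) : TangentSpace (𝓡 3) x :=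
  (star3 o x (ρ.1 x))⁻¹ • sharp (star2 o x (e.1 x))

theorem wedge_eq_apply_dualVector_smul (e : DForm M 2) (ρ : DForm M 3) (x : M)
    (hρ : ρ.1 x ≠ 0) (β : TangentSpace (𝓡 3) x [⋀^Fin 1]→ₗ[ℝ] ℝ) :
    wedge (e.1 x) β = β ![dualVector o e ρ x] • ρ.1 x := by
  have hvol : (star3 o x (ρ.1 x))⁻¹ • ρ.1 x = (o.orient x).volumeForm := by
    conv_lhs => rw [← star3_smul_volumeForm o x (ρ.1 x)]
    rw [star3_smul_volumeForm o x (ρ.1 x)]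
    nth_rewrite 2 [← star3_smul_volumeForm o x (ρ.1 x)]
    rw [inv_smul_smul₀ (star3_ne_zero o x hρ)]
  rw [wedge_eq_apply_sharp_smul_volumeForm (o.orient x), dualVector, apply_smul_one, mul_comm,
    mul_smul, hvol]
  rfl

theorem coordBasis_repr_dualVector (e : DForm M 2) (ρ : DForm M 3) (x₀ x : M)
    (hx : x ∈ (chartAt E3 x₀).source) (hρ : ρ.1 x ≠ 0) (k : Fin 3) :
    (coordBasis x₀ x hx).repr (dualVector o e ρ x) k =
      ![e.1 x ![coordBasis x₀ x hx 1, coordBasis x₀ x hx 2],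
        -e.1 x ![coordBasis x₀ x hx 0, coordBasis x₀ x hx 2],
        e.1 x ![coordBasis x₀ x hx 0, coordBasis x₀ x hx 1]] k / ρ.1 x (coordBasis x₀ x hx) := by
  set B := coordBasis x₀ x hx
  -- Applying `e ∧ β = β(X) ρ` to the coordinate covectors reads off the components of `X`; the
  -- metric has dropped out.
  let β := AlternatingMap.ofSubsingleton ℝ (TangentSpace (𝓡 3) x) ℝ (0 : Fin 1) (B.coord k)
  have hβ : ∀ u, β ![u] = B.repr u k := fun u => rfl
  have h := congrArg (fun f => f B) (wedge_eq_apply_dualVector_smul o e ρ x hρ β)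
  change wedge (e.1 x) β B = β ![dualVector o e ρ x] * ρ.1 x B at h
  rw [wedge_two_one_apply, hβ, hβ, hβ, hβ] at h
  rw [eq_div_iff (apply_basis_ne_zero B hρ), ← h]
  fin_cases k <;> simp

/-- In a chart the components are, up to sign, those of `e` divided by that of `ρ`; no regularity of
the metric enters. -/
theorem contMDiff_dualVector (e : DForm M 2) (ρ : DForm M 3) (hρ : ∀ x, ρ.1 x ≠ 0) :
    ContMDiff (𝓡 3) ((𝓡 3).prod 𝓘(ℝ, E3)) ∞
      (fun x => TotalSpace.mk' E3 x (dualVector o e ρ x)) := by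
  let b := EuclideanSpace.basisFun (Fin 3) ℝ
  refine contMDiff_section_of_repr _ (fun x₀ k x =>
    ![e.1 x ![coordVec x₀ x (b 1), coordVec x₀ x (b 2)],
      -e.1 x ![coordVec x₀ x (b 0), coordVec x₀ x (b 2)],
      e.1 x ![coordVec x₀ x (b 0), coordVec x₀ x (b 1)]] k / ρ.1 x (fun i => coordVec x₀ x (b i)))
    (fun x₀ k => ContMDiffOn.div₀ ?_ (ρ.2 x₀ b) (apply_chart_component_ne_zero ρ hρ x₀))
    fun x₀ x hx k => ?_
  · fin_cases k
    · exact contMDiffOn_apply_pair e x₀ _ _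
    · exact (contMDiffOn_apply_pair e x₀ _ _).neg
    · exact contMDiffOn_apply_pair e x₀ _ _
  · rw [coordBasis_repr_dualVector o e ρ x₀ x hx (hρ x)]
    simp only [coe_coordBasis]
    rfl

/-- The dual `(e_θ, e_ρ) ↦ ((⋆e_θ)^♯ / ⋆ρ, e_ρ - ⋆(e_θ ∧ θ) / ⋆ρ)` of the tangent map of `Φ`. -/
def dualPhi (θ : DForm M 1) (ρ : DForm M 3) (hρ : ∀ x, ρ.1 x ≠ 0) :
    VelDual M →ₗ[ℝ] LieS M where
  toFun e := (⟨fun x => dualVector o e.1 ρ x, contMDiff_dualVector o e.1 ρ hρ⟩,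
    ⟨fun x => e.2 x - ratio (frameAt x) (ρ.1 x) (wedge (e.1.1 x) (θ.1 x)),
      e.2.contMDiff.sub (contMDiff_ratio ρ (wedgeForm e.1 θ) hρ)⟩)
  map_add' a b := by
    refine Prod.ext (ContMDiffSection.ext fun x => ?_) (ContMDiffMap.ext fun x => ?_)
    · change dualVector o (a.1 + b.1) ρ x = dualVector o a.1 ρ x + dualVector o b.1 ρ x
      rw [dualVector, dualVector, dualVector, ← smul_add, ← sharp_add, star2, star2, star2,
        ← hodgeStar_add]
      rfl
    · change (a.2 x + b.2 x) - ratio (frameAt x) (ρ.1 x) (wedge (a.1.1 x + b.1.1 x) (θ.1 x)) =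
        (a.2 x - ratio (frameAt x) (ρ.1 x) (wedge (a.1.1 x) (θ.1 x))) + (b.2 x - ratio (frameAt x) (ρ.1 x) (wedge (b.1.1 x) (θ.1 x)))
      rw [wedge_add_left, map_add]
      ring
  map_smul' c a := by
    refine Prod.ext (ContMDiffSection.ext fun x => ?_) (ContMDiffMap.ext fun x => ?_)
    · change dualVector o (c • a.1) ρ x = c • dualVector o a.1 ρ x
      have h : star2 o x ((c • a.1).1 x) = c • star2 o x (a.1.1 x) := hodgeStar_smul _ _ _
      rw [dualVector, dualVector, h, sharp_smul, smul_comm]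
    · change c * a.2 x - ratio (frameAt x) (ρ.1 x) (wedge (c • a.1.1 x) (θ.1 x)) =
        c * (a.2 x - ratio (frameAt x) (ρ.1 x) (wedge (a.1.1 x) (θ.1 x)))
      rw [wedge_smul_left, map_smul, smul_eq_mul]
      ring

theorem pairS_dualPhi [T2Space M] [CompactSpace M] (θ : DForm M 1) (ρ : DForm M 3)
    (hρ : ∀ x, ρ.1 x ≠ 0) (e : VelDual M) (δ : LieSDual M) :
    pairS o (dualPhi o θ ρ hρ e) δ = pairV o e (tangentPhi θ ρ hρ δ) := by
  unfold pairS pairV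
  congr 1
  funext x
  ext w
  have h1 : contract (dualVector o e.1 ρ x) (δ.1.1 x) =
      wedge (e.1.1 x) (velocity (frameAt x) (ρ.1 x) (δ.1.1 x)) := by
    rw [wedge_eq_apply_dualVector_smul o e.1 ρ x (hρ x), ← contract_tmul,
      velocity_tmul_self _ (hρ x)]
  -- Both top forms are multiples of `ρ`, so the ratio may be taken of either one.
  have h2 : ratio (frameAt x) (ρ.1 x) (wedge (e.1.1 x) (θ.1 x)) * δ.2.1 x w =
      ratio (frameAt x) (ρ.1 x) (δ.2.1 x) * wedge (e.1.1 x) (θ.1 x) w := by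
    have e1 := congrArg (fun f => f w) (ratio_smul_self (frameAt x) (hρ x) (δ.2.1 x))
    have e2 := congrArg (fun f => f w)
      (ratio_smul_self (frameAt x) (hρ x) (wedge (e.1.1 x) (θ.1 x)))
    simp only [AlternatingMap.smul_apply, smul_eq_mul] at e1 e2
    rw [← e1, ← e2]
    ring
  have h3 := congrArg (fun f => f w) (wedge_sub_smul_right (e.1.1 x)
    (velocity (frameAt x) (ρ.1 x) (δ.1.1 x)) (θ.1 x) (ratio (frameAt x) (ρ.1 x) (δ.2.1 x)))
  change _ = wedge (e.1.1 x) (velocity (frameAt x) (ρ.1 x) (δ.1.1 x)) w -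
    ratio (frameAt x) (ρ.1 x) (δ.2.1 x) * wedge (e.1.1 x) (θ.1 x) w at h3
  change contract (dualVector o e.1 ρ x) (δ.1.1 x) w +
      (e.2 x - ratio (frameAt x) (ρ.1 x) (wedge (e.1.1 x) (θ.1 x))) * δ.2.1 x w =
    wedge (e.1.1 x) (velocity (frameAt x) (ρ.1 x) (δ.1.1 x) -
      ratio (frameAt x) (ρ.1 x) (δ.2.1 x) • θ.1 x) w + e.2 x * δ.2.1 x w
  rw [h1]
  linear_combination -h3 - h2

/-! ### Positive densities and nondegeneracy of the pairing -/

theorem chartDensity_pos_factor (x₀ x : M) (hx : x ∈ (chartAt E3 x₀).source) :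
    ∃ c : ℝ, 0 < c ∧ ∀ η : ∀ x : M, TangentSpace (𝓡 3) x [⋀^Fin 3]→ₗ[ℝ] ℝ,
      chartDensity o η x₀ x = star3 o x (η x) * c := by
  classical
  set B := coordBasis x₀ x hx with hB
  -- This factor is the absolute value of the volume form on the frame, the orientation sign
  -- cancelling its sign.
  refine ⟨(if o.orient x = B.orientation then 1 else -1) * (o.orient x).volumeForm B, ?_,
    fun η => ?_⟩
  · have hne : (o.orient x).volumeForm B ≠ 0 := by
      refine apply_basis_ne_zero B fun h => ?_
      have := star3_smul_volumeForm o x B.det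
      rw [h, smul_zero] at this
      exact B.det_ne_zero this.symm
    split_ifs with h
    · rw [one_mul]
      exact (volumeForm_pos_iff _ _).2 h
    · have := mt (volumeForm_pos_iff (o.orient x) B).1 h
      have := lt_of_le_of_ne (not_lt.1 this) hne
      linarith
  · rw [chartDensity, dif_pos hx, ← hB]
    conv_lhs => rw [← star3_smul_volumeForm o x (η x)]
    rw [AlternatingMap.smul_apply, smul_eq_mul, mul_left_comm]

/-- Up to a positive factor `⋆ρ` is the chart density, which is continuous and nonzero at `x₀`.
Local constancy of the sign makes `±ρ` smooth, even if the sign differs between components of `M`.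
-/
theorem sign_star3_eventually_eq (ρ : DForm M 3) (hρ : ∀ x, ρ.1 x ≠ 0) (x₀ : M) :
    ∀ᶠ x in 𝓝 x₀, SignType.sign (star3 o x (ρ.1 x)) = SignType.sign (star3 o x₀ (ρ.1 x₀)) := by
  have hs : (chartAt E3 x₀).source ∈ 𝓝 x₀ :=
    (chartAt E3 x₀).open_source.mem_nhds (mem_chart_source E3 x₀)
  have hsign : ∀ x ∈ (chartAt E3 x₀).source,
      SignType.sign (chartDensity o ρ.1 x₀ x) = SignType.sign (star3 o x (ρ.1 x)) := by
    intro x hx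
    obtain ⟨c, hc, h⟩ := chartDensity_pos_factor o x₀ x hx
    rw [h, sign_mul, sign_pos hc, mul_one]
  have hx₀ := mem_chart_source E3 x₀
  have hcont := (continuousOn_chartDensity o ρ x₀).continuousAt hs
  have hne : chartDensity o ρ.1 x₀ x₀ ≠ 0 := by
    obtain ⟨c, hc, h⟩ := chartDensity_pos_factor o x₀ x₀ hx₀
    rw [h]
    exact mul_ne_zero (star3_ne_zero o x₀ (hρ x₀)) hc.ne'
  filter_upwards [hs, (continuousAt_sign_of_ne_zero hne).comp hcont
    |>.eventually (IsOpen.mem_nhds (isOpen_discrete {SignType.sign (chartDensity o ρ.1 x₀ x₀)}) rfl)] with x hx h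
  rw [← hsign x hx, ← hsign x₀ hx₀]
  exact h

/-- The positive three-form `±ρ`. -/
def absForm (ρ : DForm M 3) (hρ : ∀ x, ρ.1 x ≠ 0) : DForm M 3 :=
  smulForm (fun x => ((SignType.sign (star3 o x (ρ.1 x)) : SignType) : ℝ)) (fun x₀ =>
    contMDiffAt_const.congr_of_eventuallyEq
      ((sign_star3_eventually_eq o ρ hρ x₀).mono fun _ h => congrArg _ h)) ρ

theorem star3_absForm_pos (ρ : DForm M 3) (hρ : ∀ x, ρ.1 x ≠ 0) (x : M) :
    0 < star3 o x ((absForm o ρ hρ).1 x) := by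
  have h : star3 o x ((absForm o ρ hρ).1 x) =
      ((SignType.sign (star3 o x (ρ.1 x)) : SignType) : ℝ) * star3 o x (ρ.1 x) := by
    change star3 o x (_ • ρ.1 x) = _
    rw [star3, hodgeStar_smul]
    rfl
  rw [h, sign_mul_self]
  exact abs_pos.2 (star3_ne_zero o x (hρ x))

variable [IsContMDiffRiemannianBundle (𝓡 3) ∞ E3 (fun x : M => TangentSpace (𝓡 3) x)]

/-- The one-form `⟨ξ, ·⟩`. -/
def flatForm (ξ : VField M) : DForm M 1 :=
  ⟨fun x => AlternatingMap.ofSubsingleton ℝ (TangentSpace (𝓡 3) x) ℝ (0 : Fin 1)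
      (innerₛₗ ℝ (ξ x)), fun x₀ v =>
    ContMDiffOn.inner_bundle (b := fun x : M => x) ξ.contMDiff.contMDiffOn
      (contMDiffOn_coordVec x₀ (v 0))⟩

theorem flatForm_apply (ξ : VField M) (x : M) (u : TangentSpace (𝓡 3) x) :
    (flatForm ξ).1 x ![u] = inner ℝ (ξ x) u := rfl

/-- The one-form density `θ ⊗ ρ`. -/
def tensorForm (θ : DForm M 1) (ρ : DForm M 3) : OneFormDensity M :=
  ⟨fun x => θ.1 x ⊗ₜ[ℝ] ρ.1 x, fun x₀ u v =>
    ((contMDiffOn_apply_single θ x₀ u).mul (ρ.2 x₀ v)).congr fun x _ => by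
      rw [contract_tmul]
      rfl⟩

theorem contMDiff_inner (ξ ζ : VField M) :
    ContMDiff (𝓡 3) 𝓘(ℝ) ∞ (fun x => inner ℝ (ξ x) (ζ x)) :=
  ContMDiff.inner_bundle (b := fun x : M => x) ξ.contMDiff ζ.contMDiff

theorem eq_of_forall_pairS_eq [T2Space M] [CompactSpace M] (ρ : DForm M 3)
    (hρ : ∀ x, ρ.1 x ≠ 0) (q r : LieS M) (h : ∀ δ, pairS o q δ = pairS o r δ) : q = r := by
  let μ := absForm o ρ hρ
  let ξ : VField M := q.1 - r.1
  let f : SFun M := q.2 - r.2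
  have hg : ∀ p : LieS M, ContMDiff (𝓡 3) 𝓘(ℝ) ∞ (fun x => inner ℝ (ξ x) (p.1 x) + p.2 x * f x) :=
    fun p => (contMDiff_inner ξ p.1).add (p.2.contMDiff.mul f.contMDiff)
  -- This test element makes the difference of the two pairings `∫ (|ξ|² + f²) μ`.
  let δ : LieSDual M := (tensorForm (flatForm ξ) μ, smulForm f f.contMDiff μ)
  have hpair : ∀ p : LieS M, pairS o p δ = integralM o (smulForm _ (hg p) μ).1 := by
    intro p
    unfold pairS
    congr 1
    funext x
    change contract (p.1 x) ((flatForm ξ).1 x ⊗ₜ[ℝ] μ.1 x) + p.2 x • (f x • μ.1 x) =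
      (inner ℝ (ξ x) (p.1 x) + p.2 x * f x) • μ.1 x
    rw [contract_tmul, flatForm_apply, add_smul, mul_smul]
  have hint := h δ
  rw [hpair, hpair, ← sub_eq_zero, ← integralM_sub] at hint
  have hval : ∀ x, (smulForm _ (hg q) μ - smulForm _ (hg r) μ).1 x =
      (inner ℝ (ξ x) (ξ x) + f x * f x) • μ.1 x := by
    intro x
    have e1 : ξ x = q.1 x - r.1 x := rfl
    have e2 : f x = q.2 x - r.2 x := rfl
    change (inner ℝ (ξ x) (q.1 x) + q.2 x * f x) • μ.1 x -
      (inner ℝ (ξ x) (r.1 x) + r.2 x * f x) • μ.1 x = _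
    refine (sub_smul _ _ (μ.1 x)).symm.trans (congrArg (fun c : ℝ => c • μ.1 x) ?_)
    have h3 : inner ℝ (ξ x) (ξ x) = inner ℝ (ξ x) (q.1 x) - inner ℝ (ξ x) (r.1 x) := by
      conv_lhs => rw [e1]
      rw [← inner_sub_right, ← e1]
    linear_combination -h3 - f x * e2
  have hzero := eq_zero_of_integralM_eq_zero o _ (fun x₀ x hx => by
    obtain ⟨c, hc, hd⟩ := chartDensity_pos_factor o x₀ x hx
    rw [hd, hval]
    have hs : star3 o x ((inner ℝ (ξ x) (ξ x) + f x * f x) • μ.1 x) =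
        (inner ℝ (ξ x) (ξ x) + f x * f x) * star3 o x (μ.1 x) := by
      rw [star3, hodgeStar_smul]
      rfl
    rw [hs]
    have h1 : 0 ≤ inner ℝ (ξ x) (ξ x) := real_inner_self_nonneg
    have h2 := mul_self_nonneg (f x)
    have h3 := (star3_absForm_pos o ρ hρ x).le
    exact mul_nonneg (mul_nonneg (add_nonneg h1 h2) h3) hc.le) hint
  have hx : ∀ x, ξ x = 0 ∧ f x = 0 := by
    intro x
    have h0 := hzero x
    have hμ : μ.1 x ≠ 0 := by
      intro h
      have h1 := star3_absForm_pos o ρ hρ x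
      have h2 : star3 o x ((0 : ℝ) • μ.1 x) = 0 * star3 o x (μ.1 x) := by
        rw [star3, hodgeStar_smul]
        rfl
      change 0 < star3 o x (μ.1 x) at h1
      rw [zero_smul, zero_mul] at h2
      rw [h, h2] at h1
      exact lt_irrefl _ h1
    rw [hval, smul_eq_zero, or_iff_left hμ] at h0
    have h1 : 0 ≤ inner ℝ (ξ x) (ξ x) := real_inner_self_nonneg
    have h2 := mul_self_nonneg (f x)
    have h3 := (add_eq_zero_iff_of_nonneg h1 h2).1 h0
    exact ⟨inner_self_eq_zero.1 h3.1, mul_self_eq_zero.1 h3.2⟩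
  exact Prod.ext (ContMDiffSection.ext fun x => sub_eq_zero.1 (hx x).1)
    (ContMDiffMap.ext fun x => sub_eq_zero.1 (hx x).2)

end Dual

end FluidDual

end

theorem mainTheorem3 {M : Type*} [TopologicalSpace M] [ChartedSpace E3 M]
    [IsManifold (𝓡 3) ∞ M] [T2Space M] [CompactSpace M]
    [RiemannianBundle (fun x : M => TangentSpace (𝓡 3) x)]
    [IsContMDiffRiemannianBundle (𝓡 3) ∞ E3 (fun x : M => TangentSpace (𝓡 3) x)]
    (o : MOrientation M)
    (m : OneFormDensity M) (ρ : DForm M 3) (θ : DForm M 1)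
    (hρ : ∀ x, ρ.1 x ≠ 0) (hm : ∀ x, m.1 x = θ.1 x ⊗ₜ[ℝ] ρ.1 x) :
    ∃ (T : LieSDual M →ₗ[ℝ] Vel M) (D : VelDual M →ₗ[ℝ] LieS M),
      IsTangentMapPhi (m, ρ) T ∧ IsDualMap o T D ∧
      ∀ (eθ : DForm M 2) (eρ : SFun M) (x : M),
        (D (eθ, eρ)).1 x = (star3 o x (ρ.1 x))⁻¹ • sharp (star2 o x (eθ.1 x)) ∧
        (D (eθ, eρ)).2 x =
          eρ x - star3 o x (wedge (eθ.1 x) (θ.1 x)) / star3 o x (ρ.1 x) := by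
  refine ⟨tangentPhi θ ρ hρ, dualPhi o θ ρ hρ, isTangentMapPhi_tangentPhi m θ ρ hρ hm,
    fun e q => ⟨?_, fun h => ?_⟩, fun eθ eρ x => ⟨rfl, ?_⟩⟩
  · rintro rfl δ
    exact pairS_dualPhi o θ ρ hρ e δ
  · exact eq_of_forall_pairS_eq o ρ hρ q _ fun δ => (h δ).trans (pairS_dualPhi o θ ρ hρ e δ).symm
  · rw [← ratio_eq_star3_div o x (hρ x)]
    rfl
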